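/- Let $\lambda,n\ge 0$ be integers and work with components $T_{\lambda\mu}$, $-\lambda\le\mu\le\lambda$, in the basis of real spherical harmonics of degree $\lambda$; a vector $\bm a=(a_x,a_y,a_z)\in\mathbb R^3$ is identified with an object of angular momentum $1$ (with the real harmonics labelled so that $a_{-1}=a_x$, $a_0=a_z$, $a_1=a_y$). For $\bm A$, $\bm B$ of angular momenta $L_1,L_2$ put $$(\bm A\,\widetilde\otimes\,\bm B)_{L\mu}=\sum_{M_1,M_2}C^{L\mu}_{L_1M_1L_2M_2}A_{M_1}B_{M_2},$$ where $C$ denotes the Clebsch–Gordan coefficients in the real spherical basis, and define the maximal coupling of $\bm a_1,\dots,\bm a_\lambda\in\mathbb R^3$ by $$(\bm a_1\,\widetilde\otimes\cdots\widetilde\otimes\,\bm a_\lambda)_\lambda=\Big(\cdots\big((\bm a_1\,\widetilde\otimes\,\bm a_2)_2\,\widetilde\otimes\,\bm a_3\big)_3\cdots\widetilde\otimes\,\bm a_\lambda\Big)_\lambda$$ (for $\lambda=1$ this is $\bm a_1$, and for $\lambda=0$ the empty coupling is the scalar $1$). Let $\bm T_\lambda:(\mathbb R^3)^n\to\mathbb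 R^{2\lambda+1}$ be an $O(3)$-equivariant proper harmonic tensor of angular momentum $\lambda$, that is, for all $\bm r_1,\dots,\bm r_n\in\mathbb R^3$, $$\bm T_\lambda(R\bm r_1,\dots,R\bm r_n)=\bm D^\lambda(R)\,\bm T_\lambda(\bm r_1,\dots,\bm r_n)\quad\text{for every rotation }R\in SO(3),\qquad \bm T_\lambda(-\bm r_1,\dots,-\bm r_n)=(-1)^\lambda\,\bm T_\lambda(\bm r_1,\dots,\bm r_n),$$ where $\bm D^\lambda(R)$ is the real Wigner $D$-matrix of $R$. Then for all $\bm r_1,\dots,\bm r_n\in\mathbb R^3$, $$\bm T_\lambda(\bm r_1,\dots,\bm r_n)\in\operatorname{span}_{\mathbb R}\big\{(\bm r_{i_1}\,\widetilde\otimes\cdots\widetilde\otimes\,\bm r_{i_\lambda})_\lambda\;:\;i_1,\dots,i_\lambda\in\{1,\dots,n\}\big\}.$$ -/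

import Mathlib

open scoped Matrix Nat

noncomputable section

/-- The values `-l, …, l` of the magnetic index of an object of angular momentum `l`. -/
abbrev MIdx (l : ℕ) : Type := ↥(Finset.Icc (-(l : ℤ)) (l : ℤ))

/-- `z!` for `z ≥ 0`. The value at negative `z` is irrelevant: it only occurs next to a vanishing sum. -/
def zfact (z : ℤ) : ℝ := (z.toNat ! : ℝ)

/-- `1 / z!`, with the usual convention `1 / z! = 0` for negative `z`. -/
def invFact (z : ℤ) : ℝ := if 0 ≤ z then (zfact z)⁻¹ else 0

/-- The (Condon–Shortley) Clebsch–Gordan coefficient `C^{j m}_{j₁ m₁ j₂ m₂}` of the standard complex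
spherical basis, by Racah's formula. The summand vanishes unless all factorial arguments are
non-negative, so the coefficient is zero outside the triangle `|j₁ - j₂| ≤ j ≤ j₁ + j₂`. -/
def cgCoeff (j : ℕ) (m : ℤ) (j₁ : ℕ) (m₁ : ℤ) (j₂ : ℕ) (m₂ : ℤ) : ℝ :=
  if m = m₁ + m₂ then
    Real.sqrt ((2 * j + 1) * zfact (j + j₁ - j₂) * zfact (j - j₁ + j₂) * zfact (j₁ + j₂ - j)
        / zfact (j₁ + j₂ + j + 1))
      * Real.sqrt (zfact (j + m) * zfact (j - m) * zfact (j₁ + m₁) * zfact (j₁ - m₁)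
        * zfact (j₂ + m₂) * zfact (j₂ - m₂))
      * ∑ k ∈ Finset.range (j₁ + j₂ + 1), (-1 : ℝ) ^ k * (invFact k * invFact (j₁ + j₂ - j - k)
        * invFact (j₁ - m₁ - k) * invFact (j₂ + m₂ - k)
        * invFact (j - j₂ + m₁ + k) * invFact (j - j₁ - m₂ + k))
  else 0

/-- The unitary matrix that expresses the real spherical harmonics through the complex ones,
`Yʳ_{l μ} = ∑ₘ (realBasis μ m) Y_{l m}`: the real harmonic is proportional to `cos |μ|φ` for
`μ < 0` and to `sin μφ` for `μ > 0`. For `l = 1` the labels are `-1 ↔ x`, `0 ↔ z`, `1 ↔ y`. -/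
def realBasis (μ m : ℤ) : ℂ :=
  if μ = 0 then (if m = 0 then 1 else 0)
  else if μ < 0 then
    (if m = -μ then (-1 : ℂ) ^ μ.natAbs / (Real.sqrt 2 : ℂ)
     else if m = μ then 1 / (Real.sqrt 2 : ℂ) else 0)
  else
    (if m = μ then (-1 : ℂ) ^ μ.natAbs / (Complex.I * (Real.sqrt 2 : ℂ))
     else if m = -μ then -1 / (Complex.I * (Real.sqrt 2 : ℂ)) else 0)

/-- The Clebsch–Gordan coefficient with respect to the real spherical harmonics. It is real when
`l₁ + l₂ - l` is even and purely imaginary when `l₁ + l₂ - l` is odd. -/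
def realCG (l : ℕ) (μ : MIdx l) (l₁ : ℕ) (μ₁ : MIdx l₁) (l₂ : ℕ) (μ₂ : MIdx l₂) : ℂ :=
  ∑ m : MIdx l, ∑ m₁ : MIdx l₁, ∑ m₂ : MIdx l₂,
    realBasis μ m * (cgCoeff l m l₁ m₁ l₂ m₂ : ℂ)
      * (starRingEnd ℂ (realBasis μ₁ m₁) * starRingEnd ℂ (realBasis μ₂ m₂))

/-- The Clebsch–Gordan contraction `(A ⊗̃ B)_l` of harmonic components of angular momenta `l₁`, `l₂`,
in the real spherical basis. -/
def cgContract {l₁ l₂ : ℕ} (l : ℕ) (A : MIdx l₁ → ℂ) (B : MIdx l₂ → ℂ) : MIdx l → ℂ :=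
  fun μ => ∑ μ₁ : MIdx l₁, ∑ μ₂ : MIdx l₂, realCG l μ l₁ μ₁ l₂ μ₂ * (A μ₁ * B μ₂)

/-- A vector `a = (a_x, a_y, a_z)` as an object of angular momentum one: `a₋₁ = a_x`, `a₀ = a_z`,
`a₁ = a_y`. -/
def vecComp (a : Fin 3 → ℝ) : MIdx 1 → ℂ :=
  fun μ => if (μ : ℤ) = -1 then (a 0 : ℂ) else if (μ : ℤ) = 0 then (a 2 : ℂ) else (a 1 : ℂ)

/-- The maximal Clebsch–Gordan coupling `(a₁ ⊗̃ ⋯ ⊗̃ a_l)_l`, obtained by sequentially contracting the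
vectors to the highest angular momentum. The empty coupling is the scalar `1`. -/
def maximalCoupling : (l : ℕ) → (Fin l → Fin 3 → ℝ) → MIdx l → ℂ
  | 0, _ => fun _ => 1
  | 1, a => vecComp (a 0)
  | l + 2, a => cgContract (l + 2) (maximalCoupling (l + 1) (fun i => a i.castSucc))
      (vecComp (a (Fin.last (l + 1))))

/-- Rotation by the angle `α` about the `z` axis. -/
def rotZ (α : ℝ) : Matrix (Fin 3) (Fin 3) ℝ :=
  !![Real.cos α, -Real.sin α, 0; Real.sin α, Real.cos α, 0; 0, 0, 1]

/-- Rotation by the angle `β` about the `y` axis. -/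
def rotY (β : ℝ) : Matrix (Fin 3) (Fin 3) ℝ :=
  !![Real.cos β, 0, Real.sin β; 0, 1, 0; -Real.sin β, 0, Real.cos β]

/-- The rotation with Euler angles `α, β, γ` (`z`-`y`-`z` convention). -/
def eulerRot (α β γ : ℝ) : Matrix (Fin 3) (Fin 3) ℝ := rotZ α * rotY β * rotZ γ

/-- Wigner's small `d`-matrix `d^l_{m' m}(β)`. -/
def wignerSmallD (l : ℕ) (m' m : ℤ) (β : ℝ) : ℝ :=
  Real.sqrt (zfact (l + m') * zfact (l - m') * zfact (l + m) * zfact (l - m))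
    * ∑ s ∈ Finset.range (2 * l + 1),
      (-1 : ℝ) ^ (m' - m + s).toNat
        * (invFact (l + m - s) * invFact s * invFact (m' - m + s) * invFact (l - m' - s))
        * (Real.cos (β / 2) ^ (2 * l + m - m' - 2 * s).toNat
          * Real.sin (β / 2) ^ (m' - m + 2 * s).toNat)

/-- The Wigner `D`-matrix `D^l_{m' m}(α, β, γ)` in the complex spherical basis. -/
def wignerD (l : ℕ) (m' m : ℤ) (α β γ : ℝ) : ℂ :=
  Complex.exp (-Complex.I * m' * α) * (wignerSmallD l m' m β : ℂ) * Complex.exp (-Complex.I * m * γ)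

/-- The real Wigner `D`-matrix: the Wigner `D`-matrix in the basis of real spherical harmonics. All
its entries are real; they are written as complex numbers. -/
def realWignerD (l : ℕ) (α β γ : ℝ) : Matrix (MIdx l) (MIdx l) ℂ :=
  fun μ μ' => ∑ m : MIdx l, ∑ m' : MIdx l,
    starRingEnd ℂ (realBasis μ m) * wignerD l m m' α β γ * realBasis μ' m'

/-- `T` is an `O(3)`-equivariant proper harmonic tensor of angular momentum `l` of the vector inputs
`r₁, …, rₙ`: it transforms by the real Wigner `D`-matrices when all inputs are rotated, and by
`(-1)^l` under inversion. (Every element of `O(3)` is a rotation, given by its Euler angles, or minus a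
rotation.) -/
structure IsProperHarmonicTensor (n l : ℕ) (T : (Fin n → Fin 3 → ℝ) → MIdx l → ℝ) : Prop where
  rotation : ∀ (α β γ : ℝ) (r : Fin n → Fin 3 → ℝ) (μ : MIdx l),
    (T (fun i => eulerRot α β γ *ᵥ r i) μ : ℂ)
      = ∑ μ' : MIdx l, realWignerD l α β γ μ μ' * (T r μ' : ℂ)
  inversion : ∀ (r : Fin n → Fin 3 → ℝ) (μ : MIdx l),
    T (fun i => -r i) μ = (-1 : ℝ) ^ l * T r μ

end

/-! Objects of angular momentum `l` are encoded as binary forms of degree `2 * l` in a spinor `(u,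
v)`, injectively (`binaryForm_injective`, `complexComp_injective`). Up to a nonzero constant the top
Clebsch–Gordan contraction becomes multiplication of forms (`binaryForm_cgContract`), and a vector
`a` becomes a quadratic form `vecForm a`. Maximal couplings are thus products of `l` such quadratic
forms, and the complex span in question is `V ^ l`, where `V = vecFormSpan r`. Rotations act by
linear substitution of spinors (`binaryForm_rotation`, `vecForm_eulerRot`), so the claim for `r`
implies the claim for every rotated copy of `r`.

It remains to see that the form of `T r` lies in `V ^ l` (`IsProperHarmonicTensor.tensorForm_mem`).
If the vectors span space, then `V` contains `u²`, `uv`, `v²`, and every monomial of degree `2 * l`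
is a product of `l` of these. If they span a plane, rotate it to the `xy` plane: the half turn about
`z` acts on it as inversion, so only monomials with even exponents survive, and these are products
of `u²` and `v²`. If they span a line, rotate it to the `z` axis: invariance under rotations about
it leaves only `(uv) ^ l`. If all vanish, a rotation about `y` kills this term as well when `l > 0`.

Finally, maximal couplings have real components (`conj_maximalCoupling`), so complex coefficients
may be replaced by their real parts. -/

/-- A sum over the magnetic index supported at a single value. -/
theorem MIdx.sum_eq_single {M : Type*} [AddCommMonoid M] {l : ℕ} (f : MIdx l → M) (k : ℤ)
    (hk : k ∈ Finset.Icc (-(l : ℤ)) l) (h : ∀ m : MIdx l, (m : ℤ) ≠ k → f m = 0) :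
    ∑ m, f m = f ⟨k, hk⟩ :=
  Fintype.sum_eq_single _ fun m hm => h m fun e => hm (Subtype.ext e)

/-! ### Unitarity and conjugation symmetry of the real basis -/

/-- The change of basis matrix from complex to real spherical harmonics. -/
noncomputable def realBasisMatrix (l : ℕ) : Matrix (MIdx l) (MIdx l) ℂ := fun μ m => realBasis μ m

theorem realBasis_eq_zero {μ m : ℤ} (h : m ≠ μ) (h' : m ≠ -μ) : realBasis μ m = 0 := by
  unfold realBasis
  split_ifs <;> first | rfl | omega

theorem realBasis_self_neg {μ : ℤ} (h : μ < 0) :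
    realBasis μ μ = 1 / (Real.sqrt 2 : ℂ) ∧
      realBasis μ (-μ) = (-1 : ℂ) ^ μ.natAbs / (Real.sqrt 2 : ℂ) := by
  unfold realBasis
  constructor
  · rw [if_neg (by omega), if_pos h, if_neg (by omega), if_pos rfl]
  · rw [if_neg (by omega), if_pos h, if_pos rfl]

theorem realBasis_self_pos {μ : ℤ} (h : 0 < μ) :
    realBasis μ μ = -Complex.I * ((-1 : ℂ) ^ μ.natAbs / (Real.sqrt 2 : ℂ)) ∧
      realBasis μ (-μ) = Complex.I * (1 / (Real.sqrt 2 : ℂ)) := by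
  have h2 : ((Real.sqrt 2 : ℝ) : ℂ) ≠ 0 := by
    rw [Complex.ofReal_ne_zero]; positivity
  unfold realBasis
  constructor
  · rw [if_neg (by omega), if_neg (by omega), if_pos rfl]
    field_simp; linear_combination Complex.I_sq
  · rw [if_neg (by omega), if_neg (by omega), if_neg (by omega), if_pos rfl]
    field_simp; linear_combination -Complex.I_sq

theorem realBasisMatrix_mul_conjTranspose (l : ℕ) :
    realBasisMatrix l * (realBasisMatrix l)ᴴ = 1 := by
  have h2 : ((Real.sqrt 2 : ℝ) : ℂ) * (Real.sqrt 2 : ℝ) = 2 := by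
    rw [← Complex.ofReal_mul, Real.mul_self_sqrt (by norm_num)]; norm_num
  have h2' : ((Real.sqrt 2 : ℝ) : ℂ) ≠ 0 := by
    rw [Complex.ofReal_ne_zero]; positivity
  have h2'' : ((Real.sqrt 2 : ℝ) : ℂ) ^ 2 = 2 := by rw [sq, h2]
  ext ⟨μ, hμ⟩ ⟨ν, hν⟩
  have hone : (1 : Matrix (MIdx l) (MIdx l) ℂ) ⟨μ, hμ⟩ ⟨ν, hν⟩ = if μ = ν then 1 else 0 := by
    simp [Matrix.one_apply]
  rw [hone]
  simp only [Matrix.mul_apply, Matrix.conjTranspose_apply, realBasisMatrix]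
  rw [Finset.sum_coe_sort (Finset.Icc (-(l : ℤ)) l) fun m => realBasis μ m * star (realBasis ν m)]
  -- Row `μ` is supported at `m = ±μ`, so each inner product of rows has at most two terms.
  have hsub : ({μ, -μ} : Finset ℤ) ⊆ Finset.Icc (-(l : ℤ)) l := by
    intro x hx
    have := Finset.mem_Icc.1 hμ
    simp only [Finset.mem_insert, Finset.mem_singleton, Finset.mem_Icc] at hx ⊢
    omega
  rw [← Finset.sum_subset hsub]
  swap
  · intro m _ hm
    simp only [Finset.mem_insert, Finset.mem_singleton, not_or] at hm
    rw [realBasis_eq_zero hm.1 hm.2, zero_mul]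
  have hs1 : ∀ k : ℕ, ((-1 : ℂ) ^ k) * ((-1 : ℂ) ^ k) = 1 := fun k => by
    rw [← mul_pow]; norm_num
  rcases lt_trichotomy μ 0 with h | h | h
  · rw [Finset.sum_pair (by omega)]
    obtain ⟨e1, e2⟩ := realBasis_self_neg h
    rw [e1, e2]
    by_cases hνμ : ν = μ
    · subst hνμ
      rw [e1, e2]
      simp only [Complex.star_def, map_div₀, map_pow, map_neg, map_one, Complex.conj_ofReal]
      rw [div_mul_div_comm, div_mul_div_comm, h2, hs1]; norm_num
    · rw [if_neg (fun e => hνμ e.symm)]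
      by_cases hνμ' : ν = -μ
      · subst hνμ'
        obtain ⟨f1, f2⟩ := realBasis_self_pos (show 0 < -μ by omega)
        rw [neg_neg] at f2
        rw [f1, f2]
        simp only [Complex.star_def, map_div₀, map_pow, map_neg, map_one, map_mul,
          Complex.conj_ofReal, Complex.conj_I, Int.natAbs_neg]
        field_simp
        linear_combination Complex.I * hs1 μ.natAbs
      · rw [realBasis_eq_zero (μ := ν) (by omega) (by omega),
          realBasis_eq_zero (μ := ν) (by omega) (by omega)]; simp
  · subst h
    simp only [neg_zero, Finset.mem_singleton, Finset.insert_eq_of_mem, Finset.sum_singleton]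
    by_cases hν : ν = 0
    · subst hν; simp [realBasis]
    · rw [realBasis_eq_zero (μ := ν) (by omega) (by omega), if_neg (by omega)]; simp
  · rw [Finset.sum_pair (by omega)]
    obtain ⟨e1, e2⟩ := realBasis_self_pos h
    rw [e1, e2]
    by_cases hνμ : ν = μ
    · subst hνμ
      rw [e1, e2, if_pos rfl]
      simp only [Complex.star_def, map_div₀, map_pow, map_neg, map_one, map_mul,
          Complex.conj_ofReal, Complex.conj_I]
      field_simp
      rw [h2'']
      linear_combination (-Complex.I^2) * hs1 ν.natAbs - 2 * Complex.I_sq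
    · rw [if_neg (fun e => hνμ e.symm)]
      by_cases hνμ' : ν = -μ
      · subst hνμ'
        obtain ⟨f1, f2⟩ := realBasis_self_neg (show -μ < 0 by omega)
        rw [neg_neg] at f2
        rw [f1, f2]
        simp only [Complex.star_def, map_div₀, map_pow, map_neg, map_one,
          Complex.conj_ofReal, Int.natAbs_neg]
        field_simp
        linear_combination -Complex.I * hs1 μ.natAbs
      · rw [realBasis_eq_zero (μ := ν) (by omega) (by omega),
          realBasis_eq_zero (μ := ν) (by omega) (by omega)]; simp

theorem conjTranspose_realBasisMatrix_mul (l : ℕ) :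
    (realBasisMatrix l)ᴴ * realBasisMatrix l = 1 :=
  mul_eq_one_comm.1 (realBasisMatrix_mul_conjTranspose l)

/-- This expresses that the real harmonics are real, given that conjugation sends `Y_{l m}` to
`(-1)^m Y_{l,-m}`. -/
theorem realBasis_neg_right (μ m : ℤ) :
    realBasis μ (-m) = (-1 : ℂ) ^ m.natAbs * starRingEnd ℂ (realBasis μ m) := by
  have hs1 : ∀ k : ℕ, ((-1 : ℂ) ^ k) * ((-1 : ℂ) ^ k) = 1 := fun k => by
    rw [← mul_pow]; norm_num
  by_cases h1 : m = μ
  · subst h1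
    rcases lt_trichotomy m 0 with h | h | h
    · obtain ⟨e1, e2⟩ := realBasis_self_neg h
      rw [e1, e2]; simp [div_eq_mul_inv]
    · subst h; simp [realBasis]
    · obtain ⟨e1, e2⟩ := realBasis_self_pos h
      rw [e1, e2]; simp only [map_div₀, map_pow, map_neg, map_one, map_mul,
          Complex.conj_ofReal, Complex.conj_I]
      linear_combination -(Complex.I / (Real.sqrt 2 : ℂ)) * hs1 m.natAbs
  · by_cases h2 : m = -μ
    · subst h2
      rcases lt_trichotomy μ 0 with h | h | h
      · obtain ⟨e1, e2⟩ := realBasis_self_neg h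
        rw [neg_neg, e1, e2]; simp only [map_div₀, map_pow, map_neg, map_one,
          Complex.conj_ofReal, Int.natAbs_neg]
        linear_combination -(1 / (Real.sqrt 2 : ℂ)) * hs1 μ.natAbs
      · subst h; simp [realBasis]
      · obtain ⟨e1, e2⟩ := realBasis_self_pos h
        rw [neg_neg, e1, e2]; simp only [map_div₀, map_one, map_mul,
          Complex.conj_ofReal, Complex.conj_I, Int.natAbs_neg]
        ring
    · rw [realBasis_eq_zero (by omega) (by omega), realBasis_eq_zero h1 h2]; simp

/-! ### Clebsch–Gordan coefficients of maximal coupling -/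

theorem zfact_pos (z : ℤ) : 0 < zfact z := by
  unfold zfact; exact_mod_cast Nat.factorial_pos _

theorem invFact_of_nonneg {z : ℤ} (h : 0 ≤ z) : invFact z = (zfact z)⁻¹ := if_pos h

theorem invFact_of_neg {z : ℤ} (h : z < 0) : invFact z = 0 := if_neg (by omega)

/-- The normalization `√((l + m)! (l - m)!)` of a spinor monomial. -/
noncomputable def spinorNorm (l : ℕ) (m : ℤ) : ℝ := Real.sqrt (zfact (l + m) * zfact (l - m))

theorem spinorNorm_pos (l : ℕ) (m : ℤ) : 0 < spinorNorm l m :=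
  Real.sqrt_pos.2 (mul_pos (zfact_pos _) (zfact_pos _))

theorem spinorNorm_mul_self (l : ℕ) (m : ℤ) :
    spinorNorm l m * spinorNorm l m = zfact (l + m) * zfact (l - m) :=
  Real.mul_self_sqrt (mul_pos (zfact_pos _) (zfact_pos _)).le

theorem spinorNorm_neg (l : ℕ) (m : ℤ) : spinorNorm l (-m) = spinorNorm l m := by
  unfold spinorNorm; rw [mul_comm]; congr 2; rw [sub_neg_eq_add]

/-- The constant relating the maximal Clebsch–Gordan contraction to the product of binary forms. -/
noncomputable def couplingConst (l₁ l₂ : ℕ) : ℝ :=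
  Real.sqrt ((2 * ((l₁ + l₂ : ℕ) : ℝ) + 1) * zfact (((l₁ + l₂ : ℕ) : ℤ) + l₁ - l₂)
    * zfact (((l₁ + l₂ : ℕ) : ℤ) - l₁ + l₂)
    * zfact ((l₁ : ℤ) + l₂ - (l₁ + l₂ : ℕ)) / zfact ((l₁ : ℤ) + l₂ + (l₁ + l₂ : ℕ) + 1))

theorem couplingConst_pos (l₁ l₂ : ℕ) : 0 < couplingConst l₁ l₂ := by
  refine Real.sqrt_pos.2 (div_pos (mul_pos (mul_pos (mul_pos ?_ ?_) ?_) ?_) ?_) <;>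
    first | exact zfact_pos _ | positivity

/-- In top degree Racah's sum collapses to one term, and the remaining factorials are ratios of
spinor norms: exactly the structure constants in `spinorMonomial_mul`. -/
theorem cgCoeff_maximal {l₁ l₂ : ℕ} {m m₁ m₂ : ℤ} (h₁ : m₁ ∈ Finset.Icc (-(l₁ : ℤ)) l₁)
    (h₂ : m₂ ∈ Finset.Icc (-(l₂ : ℤ)) l₂) :
    cgCoeff (l₁ + l₂) m l₁ m₁ l₂ m₂ = if m = m₁ + m₂ then
      couplingConst l₁ l₂ * (spinorNorm (l₁ + l₂) m / (spinorNorm l₁ m₁ * spinorNorm l₂ m₂))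
      else 0 := by
  rw [Finset.mem_Icc] at h₁ h₂
  unfold cgCoeff
  split_ifs with hm
  swap
  · rfl
  -- The factor `1 / (j₁ + j₂ - j - k)!` is `1 / (-k)!` here, which vanishes for `k > 0`.
  rw [Finset.sum_eq_single 0]
  rotate_left
  · intro k _ hk
    rw [invFact_of_neg (z := (l₁ : ℤ) + l₂ - (l₁ + l₂ : ℕ) - k) (by push_cast; omega)]
    simp
  · intro h; exact absurd (Finset.mem_range.2 (by omega)) h
  have e0 : ((l₁ : ℤ) + l₂ - (l₁ + l₂ : ℕ) - (0 : ℕ)) = 0 := by push_cast; ring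
  have e1 : (((l₁ + l₂ : ℕ) : ℤ) - l₂ + m₁ + (0 : ℕ)) = l₁ + m₁ := by push_cast; ring
  have e2 : (((l₁ + l₂ : ℕ) : ℤ) - l₁ - m₂ + (0 : ℕ)) = l₂ - m₂ := by push_cast; ring
  have e3 : ((l₁ : ℤ) - m₁ - (0 : ℕ)) = l₁ - m₁ := by push_cast; ring
  have e4 : ((l₂ : ℤ) + m₂ - (0 : ℕ)) = l₂ + m₂ := by push_cast; ring
  have e5 : invFact ((0 : ℕ) : ℤ) = 1 := by simp [invFact, zfact]
  have e6 : invFact (0 : ℤ) = 1 := by simp [invFact, zfact]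
  rw [e0, e1, e2, e3, e4, e5, e6, invFact_of_nonneg (by omega), invFact_of_nonneg (by omega),
    invFact_of_nonneg (by omega), invFact_of_nonneg (by omega)]
  have hs : Real.sqrt (zfact ((l₁ + l₂ : ℕ) + m) * zfact ((l₁ + l₂ : ℕ) - m) * zfact (l₁ + m₁)
      * zfact (l₁ - m₁) * zfact (l₂ + m₂) * zfact (l₂ - m₂))
      = spinorNorm (l₁ + l₂) m * spinorNorm l₁ m₁ * spinorNorm l₂ m₂ := by
    unfold spinorNorm
    rw [← Real.sqrt_mul (mul_pos (zfact_pos _) (zfact_pos _)).le,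
      ← Real.sqrt_mul (mul_pos (mul_pos (zfact_pos _) (zfact_pos _))
        (mul_pos (zfact_pos _) (zfact_pos _))).le]
    congr 1; ring
  rw [hs]
  change couplingConst l₁ l₂ * _ * _ = _
  have p1 := (spinorNorm_pos l₁ m₁).ne'
  have p2 := (spinorNorm_pos l₂ m₂).ne'
  have z1 := (zfact_pos (l₁ + m₁)).ne'
  have z2 := (zfact_pos (l₁ - m₁)).ne'
  have z3 := (zfact_pos (l₂ + m₂)).ne'
  have z4 := (zfact_pos (l₂ - m₂)).ne'
  have q1 := spinorNorm_mul_self l₁ m₁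
  have q2 := spinorNorm_mul_self l₂ m₂
  have i1 : (zfact (l₁ - m₁))⁻¹ = zfact (l₁ + m₁) * (spinorNorm l₁ m₁ * spinorNorm l₁ m₁)⁻¹ := by
    rw [q1]; field_simp
  have i2 : (zfact (l₂ - m₂))⁻¹ = zfact (l₂ + m₂) * (spinorNorm l₂ m₂ * spinorNorm l₂ m₂)⁻¹ := by
    rw [q2]; field_simp
  rw [i1, i2]
  field_simp

theorem cgCoeff_maximal_neg {l₁ l₂ : ℕ} {m m₁ m₂ : ℤ} (h₁ : m₁ ∈ Finset.Icc (-(l₁ : ℤ)) l₁)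
    (h₂ : m₂ ∈ Finset.Icc (-(l₂ : ℤ)) l₂) :
    cgCoeff (l₁ + l₂) (-m) l₁ (-m₁) l₂ (-m₂) = cgCoeff (l₁ + l₂) m l₁ m₁ l₂ m₂ := by
  have h₁' := Finset.mem_Icc.1 h₁
  have h₂' := Finset.mem_Icc.1 h₂
  rw [cgCoeff_maximal h₁ h₂, cgCoeff_maximal (Finset.mem_Icc.2 (by omega))
    (Finset.mem_Icc.2 (by omega)), spinorNorm_neg, spinorNorm_neg, spinorNorm_neg]
  exact if_congr (by omega) rfl rfl

/-! ### Binary forms and their products -/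

/-- The normalized monomial `u^(l + m) v^(l - m) / √((l + m)! (l - m)!)`, on which `SU(2)` acts by
the Wigner matrices. -/
noncomputable def spinorMonomial (l : ℕ) (m : ℤ) (w : ℂ × ℂ) : ℂ :=
  w.1 ^ (l + m).toNat * w.2 ^ (l - m).toNat / (spinorNorm l m : ℂ)

/-- The binary form of degree `2 l` with coefficients `A`. -/
noncomputable def binaryForm (l : ℕ) : (MIdx l → ℂ) →ₗ[ℂ] (ℂ × ℂ → ℂ) where
  toFun A w := ∑ m, A m * spinorMonomial l m w
  map_add' A B := by
    ext w; simp [add_mul, Finset.sum_add_distrib]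
  map_smul' c A := by
    ext w; simp [Finset.mul_sum, mul_assoc]

theorem binaryForm_apply (l : ℕ) (A : MIdx l → ℂ) (w : ℂ × ℂ) :
    binaryForm l A w = ∑ m, A m * spinorMonomial l m w := rfl

-- Setting `v = 1` turns the form into a polynomial in `u` whose exponents `l + m` are distinct, so
-- its coefficients can be read off.
open Polynomial in
theorem binaryForm_injective (l : ℕ) : Function.Injective (binaryForm l) := by
  rw [injective_iff_map_eq_zero]
  intro A hA
  set p : ℂ[X] := ∑ m : MIdx l, C (A m / (spinorNorm l m : ℂ)) * X ^ ((l : ℤ) + m).toNat with hp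
  have hp0 : p = 0 := by
    refine Polynomial.funext fun u => ?_
    have := congrFun hA (u, 1)
    simp only [binaryForm_apply, spinorMonomial, one_pow, mul_one, Pi.zero_apply] at this
    rw [hp, eval_finsetSum, eval_zero, ← this]
    refine Finset.sum_congr rfl fun m _ => ?_
    simp only [eval_mul, eval_C, eval_pow, eval_X]
    ring
  ext m
  have hc := congrArg (fun q => q.coeff ((l : ℤ) + m).toNat) hp0
  simp only [hp, finsetSum_coeff, coeff_C_mul, coeff_X_pow, coeff_zero] at hc
  rw [Fintype.sum_eq_single m] at hc
  · rw [if_pos rfl, mul_one, div_eq_zero_iff] at hc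
    exact hc.resolve_right (Complex.ofReal_ne_zero.2 (spinorNorm_pos l m).ne')
  · intro m' hm'
    rw [if_neg, mul_zero]
    have h1 := Finset.mem_Icc.1 m.2
    have h2 := Finset.mem_Icc.1 m'.2
    have h3 : (m' : ℤ) ≠ m := fun e => hm' (Subtype.ext e)
    omega

/-- The components in the complex spherical basis. -/
noncomputable def complexComp (l : ℕ) : (MIdx l → ℂ) →ₗ[ℂ] (MIdx l → ℂ) :=
  (realBasisMatrix l)ᴴ.mulVecLin

theorem complexComp_apply (l : ℕ) (A : MIdx l → ℂ) (m : MIdx l) :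
    complexComp l A m = ∑ μ : MIdx l, starRingEnd ℂ (realBasis μ m) * A μ := rfl

theorem complexComp_injective (l : ℕ) : Function.Injective (complexComp l) := by
  intro A B h
  have := congrArg (fun v => realBasisMatrix l *ᵥ v) h
  simpa [complexComp, Matrix.mulVec_mulVec, realBasisMatrix_mul_conjTranspose] using this

theorem complexComp_realBasis_mulVec (l : ℕ) (B : MIdx l → ℂ) :
    complexComp l (fun μ => ∑ m : MIdx l, realBasis μ m * B m) = B := by
  change (realBasisMatrix l)ᴴ *ᵥ (realBasisMatrix l *ᵥ B) = B
  rw [Matrix.mulVec_mulVec, conjTranspose_realBasisMatrix_mul, Matrix.one_mulVec]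

/-- The real coefficients are the complex ones conjugated by the unitary change of basis, so the
contraction takes its standard form in complex components. -/
theorem complexComp_cgContract {l₁ l₂ l : ℕ} (A : MIdx l₁ → ℂ) (B : MIdx l₂ → ℂ) (m : MIdx l) :
    complexComp l (cgContract l A B) m = ∑ m₁ : MIdx l₁, ∑ m₂ : MIdx l₂,
      (cgCoeff l m l₁ m₁ l₂ m₂ : ℂ) * (complexComp l₁ A m₁ * complexComp l₂ B m₂) := by
  have : cgContract l A B = fun μ : MIdx l => ∑ m : MIdx l, realBasis μ m *
      ∑ m₁ : MIdx l₁, ∑ m₂ : MIdx l₂,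
      (cgCoeff l m l₁ m₁ l₂ m₂ : ℂ) * (complexComp l₁ A m₁ * complexComp l₂ B m₂) := by
    ext μ
    simp only [cgContract, realCG, complexComp_apply, Finset.sum_mul,
      Finset.mul_sum]
    have comm := fun (f : MIdx l₁ → MIdx l₂ → MIdx l → MIdx l₁ → MIdx l₂ → ℂ) =>
      show ∑ μ₁, ∑ μ₂, ∑ m, ∑ m₁, ∑ m₂, f μ₁ μ₂ m m₁ m₂
        = ∑ m, ∑ m₁, ∑ m₂, ∑ μ₁, ∑ μ₂, f μ₁ μ₂ m m₁ m₂ by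
      simp only [← Fintype.sum_prod_type']
      let e : MIdx l₁ × MIdx l₂ × MIdx l × MIdx l₁ × MIdx l₂
          ≃ MIdx l × MIdx l₁ × MIdx l₂ × MIdx l₁ × MIdx l₂ :=
        ⟨fun x => (x.2.2.1, x.2.2.2.1, x.2.2.2.2, x.1, x.2.1),
          fun x => (x.2.2.2.1, x.2.2.2.2, x.1, x.2.1, x.2.2.1), fun _ => rfl, fun _ => rfl⟩
      exact Fintype.sum_equiv e _ _ fun _ => rfl
    rw [comm]
    refine Finset.sum_congr rfl fun _ _ => Finset.sum_congr rfl fun _ _ =>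
      Finset.sum_congr rfl fun _ _ => ?_
    rw [Finset.sum_comm]
    refine Finset.sum_congr rfl fun _ _ => Finset.sum_congr rfl fun _ _ => ?_
    ring
  rw [this, complexComp_realBasis_mulVec]

theorem spinorMonomial_mul {l₁ l₂ : ℕ} {m₁ m₂ : ℤ} (h₁ : m₁ ∈ Finset.Icc (-(l₁ : ℤ)) l₁)
    (h₂ : m₂ ∈ Finset.Icc (-(l₂ : ℤ)) l₂) (w : ℂ × ℂ) :
    spinorMonomial l₁ m₁ w * spinorMonomial l₂ m₂ w =
      (spinorNorm (l₁ + l₂) (m₁ + m₂) / (spinorNorm l₁ m₁ * spinorNorm l₂ m₂) : ℝ)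
        * spinorMonomial (l₁ + l₂) (m₁ + m₂) w := by
  rw [Finset.mem_Icc] at h₁ h₂
  have p1 := Complex.ofReal_ne_zero.2 (spinorNorm_pos l₁ m₁).ne'
  have p2 := Complex.ofReal_ne_zero.2 (spinorNorm_pos l₂ m₂).ne'
  have p3 := Complex.ofReal_ne_zero.2 (spinorNorm_pos (l₁ + l₂) (m₁ + m₂)).ne'
  unfold spinorMonomial
  have e1 : (((l₁ + l₂ : ℕ) : ℤ) + (m₁ + m₂)).toNat = (l₁ + m₁).toNat + (l₂ + m₂).toNat := by
    omega
  have e2 : (((l₁ + l₂ : ℕ) : ℤ) - (m₁ + m₂)).toNat = (l₁ - m₁).toNat + (l₂ - m₂).toNat := by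
    omega
  rw [e1, e2, pow_add, pow_add]
  push_cast
  field_simp

/-- The maximal Clebsch–Gordan contraction is the product of binary forms. -/
theorem binaryForm_cgContract {l₁ l₂ : ℕ} (A : MIdx l₁ → ℂ) (B : MIdx l₂ → ℂ) (w : ℂ × ℂ) :
    binaryForm (l₁ + l₂) (complexComp (l₁ + l₂) (cgContract (l₁ + l₂) A B)) w =
      couplingConst l₁ l₂ *
        (binaryForm l₁ (complexComp l₁ A) w * binaryForm l₂ (complexComp l₂ B) w) := by
  rw [binaryForm_apply, binaryForm_apply, binaryForm_apply, Finset.sum_mul_sum]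
  simp only [complexComp_cgContract, Finset.sum_mul, Finset.mul_sum]
  rw [Finset.sum_comm]
  refine Finset.sum_congr rfl fun m₁ _ => ?_
  rw [Finset.sum_comm]
  refine Finset.sum_congr rfl fun m₂ _ => ?_
  have h1 := Finset.mem_Icc.1 m₁.2
  have h2 := Finset.mem_Icc.1 m₂.2
  rw [MIdx.sum_eq_single _ ((m₁ : ℤ) + m₂) (Finset.mem_Icc.2 (by omega))]
  · rw [cgCoeff_maximal m₁.2 m₂.2, if_pos rfl]
    have := spinorMonomial_mul m₁.2 m₂.2 w
    push_cast at this ⊢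
    linear_combination (-(couplingConst l₁ l₂ : ℂ) * complexComp l₁ A m₁ * complexComp l₂ B m₂)
      * this
  · intro m hm
    rw [cgCoeff_maximal m₁.2 m₂.2, if_neg hm]
    simp

/-! ### Reality of maximal couplings -/

/-- Negation of the magnetic index. -/
def MIdx.negEquiv (l : ℕ) : MIdx l ≃ MIdx l :=
  (Equiv.neg ℤ).subtypeEquiv fun m => by
    simp only [Finset.mem_Icc, Equiv.neg_apply]; omega

theorem MIdx.coe_negEquiv {l : ℕ} (m : MIdx l) : (MIdx.negEquiv l m : ℤ) = -m := rfl

theorem conj_realBasis (μ m : ℤ) :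
    starRingEnd ℂ (realBasis μ m) = (-1 : ℂ) ^ m.natAbs * realBasis μ (-m) := by
  rw [realBasis_neg_right, ← mul_assoc, ← mul_pow]; simp

/-- Conjugation of the basis matrices amounts to negating all magnetic indices, up to signs. The
maximal coefficients are invariant under this negation, and the signs cancel because `m = m₁ + m₂`.
-/
theorem conj_realCG {l₁ l₂ : ℕ} (μ : MIdx (l₁ + l₂)) (μ₁ : MIdx l₁) (μ₂ : MIdx l₂) :
    starRingEnd ℂ (realCG (l₁ + l₂) μ l₁ μ₁ l₂ μ₂) = realCG (l₁ + l₂) μ l₁ μ₁ l₂ μ₂ := by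
  unfold realCG
  simp only [map_sum]
  rw [← Equiv.sum_comp (MIdx.negEquiv (l₁ + l₂))]
  refine Finset.sum_congr rfl fun m _ => ?_
  rw [← Equiv.sum_comp (MIdx.negEquiv l₁)]
  refine Finset.sum_congr rfl fun m₁ _ => ?_
  rw [← Equiv.sum_comp (MIdx.negEquiv l₂)]
  refine Finset.sum_congr rfl fun m₂ _ => ?_
  simp only [MIdx.coe_negEquiv, cgCoeff_maximal_neg m₁.2 m₂.2, map_mul, Complex.conj_ofReal]
  by_cases h : (m : ℤ) = m₁ + m₂
  · simp only [conj_realBasis, neg_neg, Int.natAbs_neg]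
    simp only [map_mul, map_pow, map_neg, map_one]
    rw [conj_realBasis, conj_realBasis]
    have h2 : ((-1 : ℂ) ^ (m : ℤ).natAbs) * ((-1) ^ (m₁ : ℤ).natAbs * (-1) ^ (m₂ : ℤ).natAbs)
        = 1 := by
      rw [← pow_add, ← pow_add]
      exact Even.neg_one_pow (by rw [Nat.even_iff]; omega)
    linear_combination (realBasis μ m * (cgCoeff (l₁ + l₂) m l₁ m₁ l₂ m₂ : ℂ)
      * ((-1) ^ (m₁ : ℤ).natAbs * realBasis μ₁ (-m₁)
        * ((-1) ^ (m₂ : ℤ).natAbs * realBasis μ₂ (-m₂)))) * h2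
  · rw [cgCoeff_maximal m₁.2 m₂.2, if_neg h]; simp

theorem conj_vecComp (a : Fin 3 → ℝ) (μ : MIdx 1) : starRingEnd ℂ (vecComp a μ) = vecComp a μ := by
  unfold vecComp; split_ifs <;> exact Complex.conj_ofReal _

theorem conj_maximalCoupling : ∀ (l : ℕ) (a : Fin l → Fin 3 → ℝ) (μ : MIdx l),
    starRingEnd ℂ (maximalCoupling l a μ) = maximalCoupling l a μ
  | 0, _, _ => map_one _
  | 1, a, μ => conj_vecComp (a 0) μ
  | l + 2, a, μ => by
    simp only [maximalCoupling, cgContract, map_sum, map_mul, conj_vecComp,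
      conj_maximalCoupling (l + 1)]
    refine Finset.sum_congr rfl fun μ₁ _ => Finset.sum_congr rfl fun μ₂ _ => ?_
    rw [conj_realCG (l₁ := l + 1) (l₂ := 1)]

/-! ### Maximal couplings as products of quadratic forms -/

/-- The binary quadratic form of a vector. -/
noncomputable def vecForm : (Fin 3 → ℝ) →ₗ[ℝ] (ℂ × ℂ → ℂ) where
  toFun a w := (-(a 0 + a 1 * Complex.I) * w.1 ^ 2 + 2 * a 2 * (w.1 * w.2)
    + (a 0 - a 1 * Complex.I) * w.2 ^ 2) / 2
  map_add' a b := by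
    ext w; simp only [Pi.add_apply, Complex.ofReal_add]; ring
  map_smul' c a := by
    ext w
    simp only [Pi.smul_apply, smul_eq_mul, Complex.ofReal_mul, RingHom.id_apply,
      Complex.real_smul]
    ring

theorem vecForm_apply (a : Fin 3 → ℝ) (w : ℂ × ℂ) :
    vecForm a w = (-(a 0 + a 1 * Complex.I) * w.1 ^ 2 + 2 * a 2 * (w.1 * w.2)
    + (a 0 - a 1 * Complex.I) * w.2 ^ 2) / 2 := rfl

theorem binaryForm_vecComp (a : Fin 3 → ℝ) (w : ℂ × ℂ) :
    binaryForm 1 (complexComp 1 (vecComp a)) w = vecForm a w := by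
  have hI : ∀ f : ℤ → ℂ, ∑ m : MIdx 1, f m = f (-1) + f 0 + f 1 := fun f => by
    rw [Finset.sum_coe_sort, show Finset.Icc (-((1 : ℕ) : ℤ)) ((1 : ℕ) : ℤ) = {-1, 0, 1} by decide,
      Finset.sum_insert (by decide), Finset.sum_insert (by decide), Finset.sum_singleton, add_assoc]
  have h2 : ((Real.sqrt 2 : ℝ) : ℂ) * (Real.sqrt 2 : ℝ) = 2 := by
    rw [← Complex.ofReal_mul, Real.mul_self_sqrt (by norm_num)]; norm_num
  have h2' : ((Real.sqrt 2 : ℝ) : ℂ) ≠ 0 := by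
    rw [Complex.ofReal_ne_zero]; positivity
  have hA : ∀ m : MIdx 1, complexComp 1 (vecComp a) m =
      starRingEnd ℂ (realBasis (-1) m) * a 0 + starRingEnd ℂ (realBasis 0 m) * a 2
        + starRingEnd ℂ (realBasis 1 m) * a 1 := fun m => by
    rw [complexComp_apply]
    unfold vecComp
    rw [hI fun μ => starRingEnd ℂ (realBasis μ m) *
        (if μ = -1 then (a 0 : ℂ) else if μ = 0 then (a 2 : ℂ) else (a 1 : ℂ))]
    norm_num
  rw [binaryForm_apply]
  simp only [hA]
  rw [hI fun m => (starRingEnd ℂ (realBasis (-1) m) * a 0 + starRingEnd ℂ (realBasis 0 m) * a 2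
        + starRingEnd ℂ (realBasis 1 m) * a 1) * spinorMonomial 1 m w]
  have t2 : Int.toNat 2 = 2 := rfl
  have n1 : spinorNorm 1 (-1) = Real.sqrt 2 := by norm_num [spinorNorm, zfact, t2]
  have n2 : spinorNorm 1 0 = 1 := by norm_num [spinorNorm, zfact, t2]
  have n3 : spinorNorm 1 1 = Real.sqrt 2 := by norm_num [spinorNorm, zfact, t2]
  simp only [spinorMonomial, n1, n2, n3, vecForm_apply, realBasis]
  norm_num [t2]
  field_simp
  rw [show ((Real.sqrt 2 : ℝ) : ℂ) ^ 2 = 2 by rw [sq, h2]]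
  ring

theorem exists_binaryForm_maximalCoupling : ∀ l : ℕ, ∃ K : ℂ, K ≠ 0 ∧
    ∀ (a : Fin l → Fin 3 → ℝ) (w : ℂ × ℂ),
      binaryForm l (complexComp l (maximalCoupling l a)) w = K * ∏ j, vecForm (a j) w
  | 0 => by
    refine ⟨1, one_ne_zero, fun a w => ?_⟩
    have hz : ∀ m : MIdx 0, (m : ℤ) ≠ 0 → False := fun m hm => by
      have := Finset.mem_Icc.1 m.2
      omega
    rw [binaryForm_apply, MIdx.sum_eq_single _ 0 (by simp) fun m hm => (hz m hm).elim,
      complexComp_apply, MIdx.sum_eq_single _ 0 (by simp) fun m hm => (hz m hm).elim]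
    simp [maximalCoupling, realBasis, spinorMonomial, spinorNorm, zfact]
  | 1 => ⟨1, one_ne_zero, fun a w => by
      simp [maximalCoupling, binaryForm_vecComp]⟩
  | l + 2 => by
    obtain ⟨K, hK, h⟩ := exists_binaryForm_maximalCoupling (l + 1)
    refine ⟨couplingConst (l + 1) 1 * K,
      mul_ne_zero (Complex.ofReal_ne_zero.2 (couplingConst_pos _ _).ne') hK, fun a w => ?_⟩
    rw [Fin.prod_univ_castSucc]
    have := binaryForm_cgContract (l₁ := l + 1) (l₂ := 1)
      (maximalCoupling (l + 1) (fun i => a i.castSucc)) (vecComp (a (Fin.last (l + 1)))) w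
    rw [h, binaryForm_vecComp] at this
    rw [maximalCoupling]
    refine this.trans ?_
    ring

/-! ### Rotations as substitutions of spinors -/

theorem wignerSmallD_mul_spinorMonomial (l : ℕ) (m m' : ℤ) (β : ℝ) (u v : ℂ) :
    (wignerSmallD l m' m β : ℂ) * spinorMonomial l m' (u, v) =
      ∑ s ∈ Finset.range (2 * l + 1), (spinorNorm l m : ℂ) * ((-1) ^ (m' - m + s).toNat
        * (invFact (l + m - s) * invFact s * invFact (m' - m + s) * invFact (l - m' - s) : ℝ)
        * ((Real.cos (β / 2) : ℂ) ^ (2 * l + m - m' - 2 * s).toNat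
          * (Real.sin (β / 2) : ℂ) ^ (m' - m + 2 * s).toNat)
        * (u ^ (l + m').toNat * v ^ (l - m').toNat)) := by
  have hs : Real.sqrt (zfact (l + m') * zfact (l - m') * zfact (l + m) * zfact (l - m)) =
      spinorNorm l m' * spinorNorm l m := by
    unfold spinorNorm
    rw [← Real.sqrt_mul (mul_pos (zfact_pos _) (zfact_pos _)).le]
    congr 1; ring
  have p := Complex.ofReal_ne_zero.2 (spinorNorm_pos l m').ne'
  unfold wignerSmallD spinorMonomial
  rw [hs, ← Finset.mul_sum]
  push_cast
  simp only [← Finset.sum_mul]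
  field_simp

/-- Wigner's formula is the expansion of `(c u + σ v)^(l + m) (-σ u + c v)^(l - m)` by the binomial
theorem: `s` counts the factors `v` taken from the first power, and `m'` records the total. -/
theorem spinorMonomial_rotY {l : ℕ} {m : ℤ} (hm : m ∈ Finset.Icc (-(l : ℤ)) l) (β : ℝ) (u v : ℂ) :
    spinorMonomial l m (Real.cos (β / 2) * u + Real.sin (β / 2) * v,
        -Real.sin (β / 2) * u + Real.cos (β / 2) * v) =
      ∑ m' : MIdx l, (wignerSmallD l m' m β : ℂ) * spinorMonomial l m' (u, v) := by
  simp only [fun m' : MIdx l => wignerSmallD_mul_spinorMonomial l m m' β u v]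
  rw [Finset.sum_comm]
  generalize Real.cos (β / 2) = c
  generalize Real.sin (β / 2) = σ
  rw [Finset.mem_Icc] at hm
  obtain ⟨p, hp⟩ : ∃ p : ℕ, (p : ℤ) = l + m := ⟨(l + m).toNat, by omega⟩
  obtain ⟨q, hq⟩ : ∃ q : ℕ, (q : ℤ) = l - m := ⟨(l - m).toNat, by omega⟩
  have hN := spinorNorm_mul_self l m
  have hN0 := Complex.ofReal_ne_zero.2 (spinorNorm_pos l m).ne'
  unfold spinorMonomial
  rw [← hp, ← hq] at hN ⊢
  have hN' : (spinorNorm l m : ℂ) * spinorNorm l m = (p ! : ℂ) * (q ! : ℂ) := by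
    rw [← Complex.ofReal_mul, hN]; simp [zfact]
  rw [add_comm (_ * u), add_comm (_ * u), Int.toNat_natCast, Int.toNat_natCast, add_pow, add_pow,
    Finset.sum_mul_sum, Finset.sum_div]
  -- Terms with `s > l + m` contain the reciprocal factorial of a negative number.
  rw [← Finset.sum_subset (Finset.range_mono (show p + 1 ≤ 2 * l + 1 by omega))]
  swap
  · intro s _ hs
    rw [Finset.mem_range] at hs
    refine Finset.sum_eq_zero fun m' _ => ?_
    rw [invFact_of_neg (z := (p : ℤ) - s) (by omega)]
    simp
  refine Finset.sum_congr rfl fun s hs => ?_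
  rw [Finset.mem_range] at hs
  rw [Finset.sum_div]
  have hmem : ∀ j ∈ Finset.range (q + 1), (l : ℤ) - s - j ∈ Finset.Icc (-(l : ℤ)) l := by
    intro j hj
    rw [Finset.mem_range] at hj
    rw [Finset.mem_Icc]; omega
  rw [Finset.sum_coe_sort (Finset.Icc (-(l : ℤ)) l) fun m' : ℤ => (spinorNorm l m : ℂ) *
    ((-1) ^ (m' - m + s).toNat
        * (invFact (p - s) * invFact s * invFact (m' - m + s) * invFact (l - m' - s) : ℝ)
        * ((c : ℂ) ^ (2 * l + m - m' - 2 * s).toNat * (σ : ℂ) ^ (m' - m + 2 * s).toNat)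
        * (u ^ (l + m').toNat * v ^ (l - m').toNat))]
  -- With `j` factors `v` from the second power, the exponent of `v` is `s + j = l - m'`. Any `m'`
  -- not of this form has a vanishing reciprocal factorial.
  refine Finset.sum_of_injOn (fun j : ℕ => (l : ℤ) - s - j) ?_ ?_ ?_ ?_
  · intro i _ j _ h
    simp only at h
    omega
  · intro j hj
    exact hmem j hj
  · intro m' hm' hni
    have hni' : ¬ (0 ≤ (l : ℤ) - m' - s ∧ 0 ≤ m' - m + s) := fun h => hni
      ⟨((l : ℤ) - m' - s).toNat, by simp only [Finset.coe_range, Set.mem_Iio]; omega,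
        by simp only; omega⟩
    rcases not_and_or.1 hni' with h | h
    · rw [invFact_of_neg (z := (l : ℤ) - m' - s) (by omega)]; simp
    · rw [invFact_of_neg (z := m' - m + s) (by omega)]; simp
  · intro j hj
    rw [Finset.mem_range] at hj
    have e1 : ((l : ℤ) - s - j - m + s).toNat = q - j := by omega
    have e2 : (2 * (l : ℤ) + m - (l - s - j) - 2 * s).toNat = (p - s) + j := by omega
    have e3 : ((l : ℤ) - s - j - m + 2 * s).toNat = (q - j) + s := by omega
    have e4 : ((l : ℤ) + (l - s - j)).toNat = (p - s) + (q - j) := by omega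
    have e5 : ((l : ℤ) - (l - s - j)).toNat = s + j := by omega
    have f1 : invFact ((p : ℤ) - s) = ((p - s)! : ℝ)⁻¹ := by
      rw [invFact_of_nonneg (by omega), zfact]; congr 3; omega
    have f2 : invFact (s : ℤ) = (s ! : ℝ)⁻¹ := by
      rw [invFact_of_nonneg (by omega), zfact]; congr 3
    have f3 : invFact ((l : ℤ) - s - j - m + s) = ((q - j)! : ℝ)⁻¹ := by
      rw [invFact_of_nonneg (by omega), zfact, e1]
    have f4 : invFact ((l : ℤ) - (l - s - j) - s) = (j ! : ℝ)⁻¹ := by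
      rw [invFact_of_nonneg (by omega), zfact]; congr 3; omega
    rw [e1, e2, e3, e4, e5, f1, f2, f3, f4, Nat.cast_choose ℂ (show s ≤ p by omega),
      Nat.cast_choose ℂ (show j ≤ q by omega)]
    have g1 : ((p - s)! : ℂ) ≠ 0 := Nat.cast_ne_zero.2 (Nat.factorial_ne_zero _)
    have g2 : (s ! : ℂ) ≠ 0 := Nat.cast_ne_zero.2 (Nat.factorial_ne_zero _)
    have g3 : ((q - j)! : ℂ) ≠ 0 := Nat.cast_ne_zero.2 (Nat.factorial_ne_zero _)
    have g4 : (j ! : ℂ) ≠ 0 := Nat.cast_ne_zero.2 (Nat.factorial_ne_zero _)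
    rw [div_eq_iff hN0]
    push_cast
    rw [show (-(σ : ℂ) * u) ^ (q - j) = (-1) ^ (q - j) * ((σ : ℂ) ^ (q - j) * u ^ (q - j)) by
      rw [← mul_pow, ← mul_pow]; congr 1; ring]
    simp only [pow_add, mul_pow]
    have : ∀ X : ℂ, (spinorNorm l m : ℂ) * X * spinorNorm l m = (p ! : ℂ) * (q ! : ℂ) * X :=
      fun X => by rw [← hN']; ring
    rw [this]
    ring

/-- The action on spinors of the rotation by `α` about the `z` axis. -/
noncomputable def spinorZ (α : ℝ) (w : ℂ × ℂ) : ℂ × ℂ :=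
  (Complex.exp (Complex.I * (α / 2)) * w.1, Complex.exp (-(Complex.I * (α / 2))) * w.2)

/-- The action on spinors of the rotation by `β` about the `y` axis. -/
noncomputable def spinorY (β : ℝ) (w : ℂ × ℂ) : ℂ × ℂ :=
  ((Real.cos (β / 2) : ℂ) * w.1 + (Real.sin (β / 2) : ℂ) * w.2,
    -(Real.sin (β / 2) : ℂ) * w.1 + (Real.cos (β / 2) : ℂ) * w.2)

/-- The action on spinors of the rotation with Euler angles `α, β, γ`. -/
noncomputable def spinorRot (α β γ : ℝ) (w : ℂ × ℂ) : ℂ × ℂ :=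
  spinorZ γ (spinorY β (spinorZ α w))

theorem spinorZ_zero (w : ℂ × ℂ) : spinorZ 0 w = w := by simp [spinorZ]

theorem spinorY_zero (w : ℂ × ℂ) : spinorY 0 w = w := by simp [spinorY]

theorem spinorMonomial_spinorZ {l : ℕ} {m : ℤ} (hm : m ∈ Finset.Icc (-(l : ℤ)) l) (α : ℝ)
    (w : ℂ × ℂ) : spinorMonomial l m (spinorZ α w) =
      Complex.exp (Complex.I * m * α) * spinorMonomial l m w := by
  rw [Finset.mem_Icc] at hm
  have e : Complex.exp (Complex.I * m * α) =
      Complex.exp (Complex.I * (α / 2)) ^ (l + m).toNat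
        * Complex.exp (-(Complex.I * (α / 2))) ^ (l - m).toNat := by
    rw [← Complex.exp_nat_mul, ← Complex.exp_nat_mul, ← Complex.exp_add]
    congr 1
    have h1 : (((l + m).toNat : ℕ) : ℂ) = l + m := by
      rw [← Int.cast_natCast, Int.toNat_of_nonneg (by omega)]; push_cast; rfl
    have h2 : (((l - m).toNat : ℕ) : ℂ) = l - m := by
      rw [← Int.cast_natCast, Int.toNat_of_nonneg (by omega)]; push_cast; rfl
    rw [h1, h2]; ring
  unfold spinorMonomial spinorZ
  rw [e, mul_pow, mul_pow]
  ring

/-- The components `t`, `t'` are real, so the hypothesis may be conjugated. This puts the real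
Wigner matrix in the form `U D̄ Uᴴ`, with `U` the change of basis, and therefore `D̄` acts on
complex components. -/
theorem complexComp_rotation {l : ℕ} {α β γ : ℝ} {t t' : MIdx l → ℝ}
    (h : ∀ μ, (t' μ : ℂ) = ∑ μ' : MIdx l, realWignerD l α β γ μ μ' * (t μ' : ℂ)) :
    complexComp l (fun μ => (t' μ : ℂ)) = fun m : MIdx l => ∑ m' : MIdx l,
      starRingEnd ℂ (wignerD l m m' α β γ) * complexComp l (fun μ => (t μ : ℂ)) m' := by
  have : (fun μ => (t' μ : ℂ)) = fun μ : MIdx l => ∑ m : MIdx l, realBasis μ m *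
      ∑ m' : MIdx l, starRingEnd ℂ (wignerD l m m' α β γ)
        * complexComp l (fun μ => (t μ : ℂ)) m' := by
    ext μ
    rw [← Complex.conj_ofReal, h μ]
    simp only [map_sum, map_mul, Complex.conj_ofReal, realWignerD, Complex.conj_conj,
      complexComp_apply, Finset.sum_mul, Finset.mul_sum]
    rw [Finset.sum_comm]
    refine Finset.sum_congr rfl fun m _ => ?_
    rw [Finset.sum_comm]
    refine Finset.sum_congr rfl fun m' _ => Finset.sum_congr rfl fun μ' _ => ?_
    ring
  rw [this, complexComp_realBasis_mulVec]

theorem conj_wignerD (l : ℕ) (m' m : ℤ) (α β γ : ℝ) : starRingEnd ℂ (wignerD l m' m α β γ) =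
    Complex.exp (Complex.I * m' * α) * (wignerSmallD l m' m β : ℂ)
      * Complex.exp (Complex.I * m * γ) := by
  unfold wignerD
  simp only [map_mul, ← Complex.exp_conj, map_neg, Complex.conj_I, Complex.conj_ofReal,
    map_intCast, neg_neg]

/-- The three factors of `D̄` are absorbed into the monomials from right to left. Substitution is
contravariant, so the spinor is transformed by `α` first and by `γ` last. -/
theorem binaryForm_rotation {l : ℕ} {α β γ : ℝ} {t t' : MIdx l → ℝ}
    (h : ∀ μ, (t' μ : ℂ) = ∑ μ' : MIdx l, realWignerD l α β γ μ μ' * (t μ' : ℂ)) (w : ℂ × ℂ) :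
    binaryForm l (complexComp l (fun μ => (t' μ : ℂ))) w =
      binaryForm l (complexComp l (fun μ => (t μ : ℂ))) (spinorRot α β γ w) := by
  rw [complexComp_rotation h, binaryForm_apply, binaryForm_apply]
  simp only [Finset.sum_mul, conj_wignerD]
  rw [Finset.sum_comm]
  refine Finset.sum_congr rfl fun m _ => ?_
  rw [spinorRot, spinorMonomial_spinorZ m.2]
  have := spinorMonomial_rotY m.2 β (spinorZ α w).1 (spinorZ α w).2
  rw [spinorY, this, Finset.mul_sum, Finset.mul_sum]
  refine Finset.sum_congr rfl fun m' _ => ?_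
  rw [Prod.mk.eta, spinorMonomial_spinorZ m'.2]
  ring

theorem vecForm_rotZ (α : ℝ) (a : Fin 3 → ℝ) (w : ℂ × ℂ) :
    vecForm (rotZ α *ᵥ a) w = vecForm a (spinorZ α w) := by
  have e1 : Complex.exp (Complex.I * (α / 2)) ^ 2 = Real.cos α + Real.sin α * Complex.I := by
    rw [← Complex.exp_nat_mul, Complex.ofReal_cos, Complex.ofReal_sin, ← Complex.exp_mul_I]
    congr 1; push_cast; ring
  have e2 : Complex.exp (-(Complex.I * (α / 2))) ^ 2 = Real.cos α - Real.sin α * Complex.I := by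
    rw [← Complex.exp_nat_mul, Complex.ofReal_cos, Complex.ofReal_sin, sub_eq_add_neg,
      ← neg_mul (Complex.sin _),
      ← Complex.sin_neg, ← Complex.cos_neg, ← Complex.exp_mul_I]
    congr 1; push_cast; ring
  have e3 : Complex.exp (Complex.I * (α / 2)) * Complex.exp (-(Complex.I * (α / 2))) = 1 := by
    rw [← Complex.exp_add]; simp
  simp only [vecForm_apply, spinorZ, mul_pow, e1, e2, rotZ, Matrix.mulVec, dotProduct,
    Fin.sum_univ_three, Matrix.of_apply, Matrix.cons_val]
  push_cast
  linear_combination (-(a 2 : ℂ) * w.1 * w.2) * e3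
    + (a 1 * Complex.sin α * (w.1 ^ 2 - w.2 ^ 2) / 2 : ℂ) * Complex.I_sq

theorem vecForm_rotY (β : ℝ) (a : Fin 3 → ℝ) (w : ℂ × ℂ) :
    vecForm (rotY β *ᵥ a) w = vecForm a (spinorY β w) := by
  have hb : (β : ℝ) = 2 * (β / 2) := by ring
  have e1 : Real.cos β = Real.cos (β / 2) ^ 2 - Real.sin (β / 2) ^ 2 := by
    conv_lhs => rw [hb]
    rw [Real.cos_two_mul']
  have e2 : Real.sin β = 2 * Real.sin (β / 2) * Real.cos (β / 2) := by
    conv_lhs => rw [hb]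
    rw [Real.sin_two_mul]
  have e3 : (Real.cos (β / 2) : ℂ) ^ 2 + (Real.sin (β / 2) : ℂ) ^ 2 = 1 := by
    rw [← Complex.ofReal_pow, ← Complex.ofReal_pow, ← Complex.ofReal_add, Real.cos_sq_add_sin_sq,
      Complex.ofReal_one]
  simp only [vecForm_apply, spinorY, rotY, Matrix.mulVec, dotProduct,
    Fin.sum_univ_three, Matrix.of_apply, Matrix.cons_val, e1, e2]
  generalize Real.cos (β / 2) = c at *
  generalize Real.sin (β / 2) = s at *
  push_cast
  linear_combination (a 1 * Complex.I * (w.1 ^ 2 + w.2 ^ 2) / 2 : ℂ) * e3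

theorem vecForm_eulerRot (α β γ : ℝ) (a : Fin 3 → ℝ) (w : ℂ × ℂ) :
    vecForm (eulerRot α β γ *ᵥ a) w = vecForm a (spinorRot α β γ w) := by
  rw [eulerRot, ← Matrix.mulVec_mulVec, ← Matrix.mulVec_mulVec, vecForm_rotZ, vecForm_rotY,
    vecForm_rotZ, spinorRot]

/-! ### Powers of the span of the quadratic forms -/

/-- The quadratic forms of the vectors `r i` and of their complex linear combinations. -/
noncomputable def vecFormSpan {n : ℕ} (r : Fin n → Fin 3 → ℝ) : Submodule ℂ (ℂ × ℂ → ℂ) :=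
  Submodule.span ℂ (Set.range fun i => vecForm (r i))

/-- Precomposition as an algebra homomorphism. -/
def precompAlgHom (g : ℂ × ℂ → ℂ × ℂ) : (ℂ × ℂ → ℂ) →ₐ[ℂ] (ℂ × ℂ → ℂ) where
  toFun f := f ∘ g
  map_one' := rfl
  map_mul' _ _ := rfl
  map_zero' := rfl
  map_add' _ _ := rfl
  commutes' _ := rfl

/-- Substitution is an algebra homomorphism mapping the span for `r` onto the span for the rotated
vectors, so it also maps powers onto powers. -/
theorem comp_mem_vecFormSpan_pow {n : ℕ} {r : Fin n → Fin 3 → ℝ} {l : ℕ} {f : ℂ × ℂ → ℂ}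
    (hf : f ∈ vecFormSpan r ^ l) (α β γ : ℝ) :
    f ∘ spinorRot α β γ ∈ vecFormSpan (fun i => eulerRot α β γ *ᵥ r i) ^ l := by
  have h : vecFormSpan (fun i => eulerRot α β γ *ᵥ r i) =
      (vecFormSpan r).map (precompAlgHom (spinorRot α β γ)).toLinearMap := by
    unfold vecFormSpan
    rw [Submodule.map_span, ← Set.range_comp]
    congr 2
    ext i w
    exact vecForm_eulerRot α β γ (r i) w
  rw [h, ← Submodule.map_pow]
  exact Submodule.mem_map_of_mem (f := (precompAlgHom (spinorRot α β γ)).toLinearMap) hf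

theorem vecForm_mem_vecFormSpan {n : ℕ} {r : Fin n → Fin 3 → ℝ} {a : Fin 3 → ℝ}
    (ha : a ∈ Submodule.span ℝ (Set.range r)) : vecForm a ∈ vecFormSpan r := by
  have : Submodule.span ℝ (Set.range r) ≤
      ((vecFormSpan r).restrictScalars ℝ).comap vecForm := by
    rw [Submodule.span_le]
    rintro _ ⟨i, rfl⟩
    exact Submodule.subset_span ⟨i, rfl⟩
  exact this ha

theorem fst_mul_snd_mem {n : ℕ} {r : Fin n → Fin 3 → ℝ}
    (hz : ![0, 0, 1] ∈ Submodule.span ℝ (Set.range r)) :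
    (fun w : ℂ × ℂ => w.1 * w.2) ∈ vecFormSpan r := by
  convert vecForm_mem_vecFormSpan hz using 1
  ext w
  simp [vecForm_apply]

/-- The unit vectors along `x` and `y` have forms `(v² - u²) / 2` and `-i (u² + v²) / 2`. Isolating
`u²` requires the complex coefficient `i`, whence the detour through complex spans. -/
theorem fst_sq_mem {n : ℕ} {r : Fin n → Fin 3 → ℝ}
    (hx : ![1, 0, 0] ∈ Submodule.span ℝ (Set.range r))
    (hy : ![0, 1, 0] ∈ Submodule.span ℝ (Set.range r)) :
    (fun w : ℂ × ℂ => w.1 ^ 2) ∈ vecFormSpan r := by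
  have := add_mem (neg_mem (vecForm_mem_vecFormSpan hx))
    (Submodule.smul_mem _ Complex.I (vecForm_mem_vecFormSpan hy))
  convert this using 1
  ext w
  simp [vecForm_apply]
  linear_combination ((w.1 ^ 2 + w.2 ^ 2) / 2) * Complex.I_sq

theorem snd_sq_mem {n : ℕ} {r : Fin n → Fin 3 → ℝ}
    (hx : ![1, 0, 0] ∈ Submodule.span ℝ (Set.range r))
    (hy : ![0, 1, 0] ∈ Submodule.span ℝ (Set.range r)) :
    (fun w : ℂ × ℂ => w.2 ^ 2) ∈ vecFormSpan r := by
  have := add_mem (vecForm_mem_vecFormSpan hx)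
    (Submodule.smul_mem _ Complex.I (vecForm_mem_vecFormSpan hy))
  convert this using 1
  ext w
  simp [vecForm_apply]
  linear_combination ((w.1 ^ 2 + w.2 ^ 2) / 2) * Complex.I_sq

theorem pow_mem_vecFormSpan_pow {n : ℕ} {r : Fin n → Fin 3 → ℝ} {f : ℂ × ℂ → ℂ}
    (hf : f ∈ vecFormSpan r) (k : ℕ) : f ^ k ∈ vecFormSpan r ^ k :=
  Submodule.pow_mem_pow _ hf k

theorem pow_mul_pow_mem_vecFormSpan_pow {n : ℕ} {r : Fin n → Fin 3 → ℝ} {f g : ℂ × ℂ → ℂ}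
    (hf : f ∈ vecFormSpan r) (hg : g ∈ vecFormSpan r) {k k' l : ℕ} (hl : k + k' = l) :
    f ^ k * g ^ k' ∈ vecFormSpan r ^ l := by
  rw [← hl, pow_add]
  exact Submodule.mul_mem_mul (Submodule.pow_mem_pow _ hf k) (Submodule.pow_mem_pow _ hg k')

/-- A binary form lies in a subspace if its nonvanishing terms do. -/
theorem binaryForm_mem {l : ℕ} {A : MIdx l → ℂ} {S : Submodule ℂ (ℂ × ℂ → ℂ)}
    (h : ∀ m : MIdx l, A m ≠ 0 →
      (fun w : ℂ × ℂ => w.1 ^ ((l : ℤ) + m).toNat * w.2 ^ ((l : ℤ) - m).toNat) ∈ S) :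
    binaryForm l A ∈ S := by
  have : binaryForm l A = ∑ m : MIdx l, (A m / (spinorNorm l m : ℂ)) •
      (fun w : ℂ × ℂ => w.1 ^ ((l : ℤ) + m).toNat * w.2 ^ ((l : ℤ) - m).toNat) := by
    ext w
    rw [binaryForm_apply, Finset.sum_apply]
    refine Finset.sum_congr rfl fun m _ => ?_
    simp only [spinorMonomial, Pi.smul_apply, smul_eq_mul]
    ring
  rw [this]
  refine sum_mem fun m _ => ?_
  by_cases hm : A m = 0
  · simp [hm]
  · exact S.smul_mem _ (h m hm)

/-- For `m ≥ 0`, `u^(l + m) v^(l - m) = (u²)^m (uv)^(l - m)`; for `m ≤ 0` exchange `u` and `v`. No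
symmetry of the coefficients is needed. -/
theorem binaryForm_mem_of_span_eq_top {n l : ℕ} {r : Fin n → Fin 3 → ℝ}
    (h : Submodule.span ℝ (Set.range r) = ⊤) (A : MIdx l → ℂ) :
    binaryForm l A ∈ vecFormSpan r ^ l := by
  have hm : ∀ a, a ∈ Submodule.span ℝ (Set.range r) := fun a => h ▸ Submodule.mem_top
  refine binaryForm_mem fun m _ => ?_
  have hm' := Finset.mem_Icc.1 m.2
  rcases le_total 0 (m : ℤ) with h0 | h0
  · obtain ⟨k, hk⟩ := Int.eq_ofNat_of_zero_le h0
    obtain ⟨j, rfl⟩ := Nat.exists_eq_add_of_le (show k ≤ l by omega)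
    convert pow_mul_pow_mem_vecFormSpan_pow (fst_sq_mem (hm _) (hm _)) (fst_mul_snd_mem (hm _))
      (show k + j = k + j from rfl) using 1
    ext w
    rw [show (((k + j : ℕ) : ℤ) + m).toNat = 2 * k + j by omega,
      show (((k + j : ℕ) : ℤ) - m).toNat = j by omega]
    simp only [Pi.mul_apply, Pi.pow_apply]
    ring
  · obtain ⟨k, hk⟩ := Int.eq_ofNat_of_zero_le (show 0 ≤ -(m : ℤ) by omega)
    obtain ⟨j, rfl⟩ := Nat.exists_eq_add_of_le (show k ≤ l by omega)
    convert pow_mul_pow_mem_vecFormSpan_pow (snd_sq_mem (hm _) (hm _)) (fst_mul_snd_mem (hm _))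
      (show k + j = k + j from rfl) using 1
    ext w
    rw [show (((k + j : ℕ) : ℤ) + m).toNat = j by omega,
      show (((k + j : ℕ) : ℤ) - m).toNat = 2 * k + j by omega]
    simp only [Pi.mul_apply, Pi.pow_apply]
    ring

theorem coeff_eq_of_binaryForm_spinorZ {l : ℕ} {A B : MIdx l → ℂ} {α : ℝ}
    (h : ∀ w, binaryForm l B w = binaryForm l A (spinorZ α w)) (m : MIdx l) :
    B m = Complex.exp (Complex.I * (m : ℤ) * α) * A m := by
  have : B = fun m : MIdx l => Complex.exp (Complex.I * (m : ℤ) * α) * A m := by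
    refine binaryForm_injective l (funext fun w => ?_)
    rw [h, binaryForm_apply, binaryForm_apply]
    refine Finset.sum_congr rfl fun m _ => ?_
    rw [spinorMonomial_spinorZ m.2]
    ring
  exact congrFun this m

/-! ### Euler rotations and alignment with the `z` axis -/

theorem rotZ_mul (α β : ℝ) : rotZ α * rotZ β = rotZ (α + β) := by
  ext i j
  fin_cases i <;> fin_cases j <;>
    simp [rotZ, Matrix.mul_apply, Fin.sum_univ_three, Real.cos_add, Real.sin_add] <;> ring

theorem rotY_mul (α β : ℝ) : rotY α * rotY β = rotY (α + β) := by
  ext i j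
  fin_cases i <;> fin_cases j <;>
    simp [rotY, Matrix.mul_apply, Fin.sum_univ_three, Real.cos_add, Real.sin_add] <;> ring

theorem rotZ_zero : rotZ 0 = 1 := by
  ext i j
  fin_cases i <;> fin_cases j <;> simp [rotZ]

theorem rotY_zero : rotY 0 = 1 := by
  ext i j
  fin_cases i <;> fin_cases j <;> simp [rotY]

theorem eulerRot_mul_neg (α β γ : ℝ) : eulerRot α β γ * eulerRot (-γ) (-β) (-α) = 1 := by
  have h : ∀ a b c b' a' : Matrix (Fin 3) (Fin 3) ℝ, ∀ c', c * c' = 1 → b * b' = 1 → a * a' = 1 →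
      a * b * c * (c' * b' * a') = 1 := by
    intro a b c b' a' c' hc hb ha
    calc a * b * c * (c' * b' * a') = a * (b * ((c * c') * b')) * a' := by noncomm_ring
      _ = 1 := by rw [hc, one_mul, hb, mul_one, ha]
  refine h _ _ _ _ _ _ ?_ ?_ ?_
  · rw [rotZ_mul, add_neg_cancel, rotZ_zero]
  · rw [rotY_mul, add_neg_cancel, rotY_zero]
  · rw [rotZ_mul, add_neg_cancel, rotZ_zero]

theorem eulerRot_transpose (α β γ : ℝ) : (eulerRot α β γ)ᵀ = eulerRot (-γ) (-β) (-α) := by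
  have hz : ∀ α, (rotZ α)ᵀ = rotZ (-α) := fun α => by
    ext i j; fin_cases i <;> fin_cases j <;> simp [rotZ]
  have hy : ∀ α, (rotY α)ᵀ = rotY (-α) := fun α => by
    ext i j; fin_cases i <;> fin_cases j <;> simp [rotY]
  rw [eulerRot, Matrix.transpose_mul, Matrix.transpose_mul, hz, hz, hy, eulerRot, mul_assoc]

theorem exists_polar (x y : ℝ) : ∃ ρ θ : ℝ, x = ρ * Real.cos θ ∧ y = ρ * Real.sin θ :=
  ⟨‖(⟨x, y⟩ : ℂ)‖, Complex.arg ⟨x, y⟩, (Complex.norm_mul_cos_arg ⟨x, y⟩).symm,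
    (Complex.norm_mul_sin_arg ⟨x, y⟩).symm⟩

/-- Every vector is a rotated multiple of the unit vector along the `z` axis. -/
theorem exists_eulerRot_mulVec (w : Fin 3 → ℝ) :
    ∃ α β c : ℝ, w = eulerRot α β 0 *ᵥ ![0, 0, c] := by
  obtain ⟨ρ, α, h0, h1⟩ := exists_polar (w 0) (w 1)
  obtain ⟨c, β, h2, h3⟩ := exists_polar (w 2) ρ
  refine ⟨α, β, c, ?_⟩
  rw [eulerRot, rotZ_zero, mul_one, ← Matrix.mulVec_mulVec]
  ext i
  fin_cases i
  · simp [rotZ, rotY, Matrix.mulVec, dotProduct, Fin.sum_univ_three, h0, h3]; ring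
  · simp [rotZ, rotY, Matrix.mulVec, dotProduct, Fin.sum_univ_three, h1, h3]; ring
  · simp [rotZ, rotY, Matrix.mulVec, dotProduct, Fin.sum_univ_three, h2]; ring

/-! ### Harmonic tensors, by the dimension of the span of their inputs -/

variable {n l : ℕ} {T : (Fin n → Fin 3 → ℝ) → MIdx l → ℝ}

/-- The binary form of the value of a harmonic tensor. -/
noncomputable def tensorForm (T : (Fin n → Fin 3 → ℝ) → MIdx l → ℝ) (r : Fin n → Fin 3 → ℝ) :
    ℂ × ℂ → ℂ :=
  binaryForm l (complexComp l fun μ => (T r μ : ℂ))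

theorem IsProperHarmonicTensor.tensorForm_rotation (hT : IsProperHarmonicTensor n l T)
    (α β γ : ℝ) (r : Fin n → Fin 3 → ℝ) :
    tensorForm T (fun i => eulerRot α β γ *ᵥ r i) = tensorForm T r ∘ spinorRot α β γ :=
  funext fun w => binaryForm_rotation (hT.rotation α β γ r) w

theorem IsProperHarmonicTensor.tensorForm_mem_rotation (hT : IsProperHarmonicTensor n l T)
    (α β γ : ℝ) {r : Fin n → Fin 3 → ℝ} (h : tensorForm T r ∈ vecFormSpan r ^ l) :
    tensorForm T (fun i => eulerRot α β γ *ᵥ r i) ∈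
      vecFormSpan (fun i => eulerRot α β γ *ᵥ r i) ^ l := by
  rw [hT.tensorForm_rotation]
  exact comp_mem_vecFormSpan_pow h α β γ

theorem eulerRot_mulVec_zAxis (α : ℝ) {v : Fin 3 → ℝ} (h0 : v 0 = 0) (h1 : v 1 = 0) :
    eulerRot α 0 0 *ᵥ v = v := by
  rw [eulerRot, rotZ_zero, rotY_zero, mul_one, mul_one]
  ext i
  fin_cases i <;> simp [rotZ, Matrix.mulVec, dotProduct, Fin.sum_univ_three, h0, h1]

theorem eulerRot_pi_mulVec {v : Fin 3 → ℝ} (h : v 2 = 0) : eulerRot Real.pi 0 0 *ᵥ v = -v := by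
  rw [eulerRot, rotZ_zero, rotY_zero, mul_one, mul_one]
  ext i
  fin_cases i <;> simp [rotZ, Matrix.mulVec, dotProduct, Fin.sum_univ_three, h]

theorem spinorRot_zero_zero (α : ℝ) (w : ℂ × ℂ) : spinorRot α 0 0 w = spinorZ α w := by
  rw [spinorRot, spinorY_zero, spinorZ_zero]

/-- Vectors along the `z` axis. -/
theorem IsProperHarmonicTensor.tensorForm_mem_of_zAxis (hT : IsProperHarmonicTensor n l T)
    {r : Fin n → Fin 3 → ℝ} (h0 : ∀ i, r i 0 = 0) (h1 : ∀ i, r i 1 = 0) :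
    tensorForm T r ∈ vecFormSpan r ^ l := by
  set A := complexComp l fun μ => (T r μ : ℂ) with hA
  have hinv : ∀ α w, binaryForm l A w = binaryForm l A (spinorZ α w) := fun α w => by
    have := congrFun (hT.tensorForm_rotation α 0 0 r) w
    rw [funext fun i => eulerRot_mulVec_zAxis α (h0 i) (h1 i), Function.comp_apply,
      spinorRot_zero_zero] at this
    exact this
  have hAm : ∀ m : MIdx l, A m ≠ 0 → (m : ℤ) = 0 := fun m hm => by
    by_contra hne
    -- The angle `π / m` makes the phase `e^(i m α)` equal to `-1`, which forces `A m = -A m`.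
    have h := coeff_eq_of_binaryForm_spinorZ (hinv (Real.pi / (m : ℤ))) m
    have hne' : ((m : ℤ) : ℂ) ≠ 0 := Int.cast_ne_zero.2 hne
    have e : Complex.I * (m : ℤ) * ((Real.pi / (m : ℤ) : ℝ) : ℂ) = Real.pi * Complex.I := by
      push_cast; field_simp
    rw [e, Complex.exp_pi_mul_I] at h
    exact hm (by linear_combination h / 2)
  by_cases hr : ∃ i, r i 2 ≠ 0
  · obtain ⟨i, hi⟩ := hr
    have huv : (fun w : ℂ × ℂ => w.1 * w.2) ∈ vecFormSpan r := by
      have : (![0, 0, 1] : Fin 3 → ℝ) = (r i 2)⁻¹ • r i := by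
        ext j; fin_cases j <;> simp [h0, h1, hi]
      exact fst_mul_snd_mem (this ▸ Submodule.smul_mem _ _ (Submodule.subset_span ⟨i, rfl⟩))
    refine binaryForm_mem fun m hm => ?_
    convert pow_mem_vecFormSpan_pow huv l using 1
    ext w
    rw [hAm m hm]
    simp [mul_pow]
  · push Not at hr
    have hr0 : r = fun _ => 0 := by
      ext i j; fin_cases j <;> simp [h0, h1, hr]
    rcases Nat.eq_zero_or_pos l with rfl | hl
    · refine binaryForm_mem fun m hm => ?_
      have h1 := Submodule.one_le.1 (le_refl (1 : Submodule ℂ (ℂ × ℂ → ℂ)))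
      rw [pow_zero]
      convert h1 using 1
      ext w
      simp [hAm m hm]
    · have hz : ∀ w, binaryForm l A w =
          A ⟨0, by simp⟩ * ((w.1 * w.2) ^ l / (spinorNorm l 0 : ℂ)) := fun w => by
        rw [binaryForm_apply, MIdx.sum_eq_single _ 0 (by simp)]
        · simp [spinorMonomial, mul_pow]
        · intro m hm
          rw [not_ne_iff.1 (mt (hAm m) hm), zero_mul]
      -- The zero configuration is fixed by every rotation. At the spinor `(1, 0)` the form `(uv)^l`
      -- vanishes for `l > 0`, but at its image `(cos π/4, -sin π/4)` it does not, so the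
      -- coefficient must be zero.
      have := congrFun (hT.tensorForm_rotation 0 (Real.pi / 2) 0 r) (1, 0)
      rw [show (fun i => eulerRot 0 (Real.pi / 2) 0 *ᵥ r i) = r by rw [hr0]; simp] at this
      change binaryForm l A _ = binaryForm l A _ at this
      have hN := Complex.ofReal_ne_zero.2 (spinorNorm_pos l 0).ne'
      have hs : (Real.sqrt 2 : ℂ) ≠ 0 := by rw [Complex.ofReal_ne_zero]; positivity
      rw [hz, hz, spinorRot, spinorZ_zero, spinorZ_zero, spinorY,
        show Real.pi / 2 / 2 = Real.pi / 4 by ring, Real.cos_pi_div_four,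
        Real.sin_pi_div_four] at this
      have hA0 : A ⟨0, by simp⟩ = 0 := by
        by_contra hne
        simp only [zero_pow hl.ne', zero_div, mul_zero, add_zero, mul_one] at this
        have h3 := (mul_eq_zero.1 this.symm).resolve_left hne
        rw [div_eq_zero_iff] at h3
        have h4 := eq_zero_of_pow_eq_zero (h3.resolve_right hN)
        push_cast at h4
        rw [mul_neg, neg_eq_zero, mul_self_eq_zero, div_eq_zero_iff] at h4
        exact h4.elim hs two_ne_zero
      have : tensorForm T r = 0 := funext fun w => by
        change binaryForm l A w = 0
        rw [hz, hA0, zero_mul]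
      rw [this]
      exact zero_mem _

theorem eulerRot_mulVec_neg_mulVec (α β γ : ℝ) (v : Fin 3 → ℝ) :
    eulerRot α β γ *ᵥ (eulerRot (-γ) (-β) (-α) *ᵥ v) = v := by
  rw [Matrix.mulVec_mulVec, eulerRot_mul_neg, Matrix.one_mulVec]

theorem IsProperHarmonicTensor.tensorForm_mem_of_collinear (hT : IsProperHarmonicTensor n l T)
    {r : Fin n → Fin 3 → ℝ} (w : Fin 3 → ℝ) (h : ∀ i, ∃ k : ℝ, r i = k • w) :
    tensorForm T r ∈ vecFormSpan r ^ l := by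
  obtain ⟨α, β, c, rfl⟩ := exists_eulerRot_mulVec w
  choose k hk using h
  have hr : r = fun i => eulerRot α β 0 *ᵥ (k i • ![0, 0, c]) :=
    funext fun i => by rw [hk, Matrix.mulVec_smul]
  rw [hr]
  refine hT.tensorForm_mem_rotation α β 0 (hT.tensorForm_mem_of_zAxis ?_ ?_) <;> simp

/-- Vectors in the `xy` plane. -/
theorem IsProperHarmonicTensor.tensorForm_mem_of_xyPlane (hT : IsProperHarmonicTensor n l T)
    {r : Fin n → Fin 3 → ℝ} (h2 : ∀ i, r i 2 = 0) :
    tensorForm T r ∈ vecFormSpan r ^ l := by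
  by_cases hdet : ∃ i j, r i 0 * r j 1 - r i 1 * r j 0 ≠ 0
  swap
  · push Not at hdet
    by_cases hr : ∃ i, r i ≠ 0
    · obtain ⟨i, hi⟩ := hr
      refine hT.tensorForm_mem_of_collinear (r i) fun j => ?_
      by_cases hx : r i 0 = 0
      · have hy : r i 1 ≠ 0 := fun hy => hi (by ext a; fin_cases a <;> simp [hx, hy, h2])
        refine ⟨r j 1 / r i 1, ?_⟩
        have := hdet i j
        rw [hx, zero_mul, zero_sub, neg_eq_zero, mul_eq_zero] at this
        ext a
        fin_cases a
        · simp [hx, this.resolve_left hy]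
        · simp [hy]
        · simp [h2]
      · refine ⟨r j 0 / r i 0, ?_⟩
        have := hdet i j
        ext a
        fin_cases a
        · simp [hx]
        · simp only [Fin.mk_one, Pi.smul_apply, smul_eq_mul]
          field_simp
          linear_combination this
        · simp [h2]
    · push Not at hr
      exact hT.tensorForm_mem_of_collinear 0 fun i => ⟨0, by rw [hr i, smul_zero]⟩
  obtain ⟨i, j, hd⟩ := hdet
  obtain ⟨d, hd'⟩ : ∃ d, r i 0 * r j 1 - r i 1 * r j 0 = d := ⟨_, rfl⟩
  rw [hd'] at hd
  have mem : ∀ a b : ℝ, a • r i + b • r j ∈ Submodule.span ℝ (Set.range r) := fun a b =>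
    add_mem (Submodule.smul_mem _ _ (Submodule.subset_span ⟨i, rfl⟩))
      (Submodule.smul_mem _ _ (Submodule.subset_span ⟨j, rfl⟩))
  -- Cramer's rule for two independent vectors of the plane; likewise for the `y` axis.
  have hx : ![1, 0, 0] ∈ Submodule.span ℝ (Set.range r) := by
    convert mem (r j 1 / d) (-r i 1 / d) using 1
    ext a
    fin_cases a <;> simp [h2] <;> field_simp <;> linarith
  have hy : ![0, 1, 0] ∈ Submodule.span ℝ (Set.range r) := by
    convert mem (-r j 0 / d) (r i 0 / d) using 1
    ext a
    fin_cases a <;> simp [h2] <;> field_simp <;> linarith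
  set A := complexComp l fun μ => (T r μ : ℂ) with hA
  -- On the `xy` plane the half turn about `z` coincides with inversion, so the rotation law and the
  -- parity law can be compared.
  have hinv : ∀ w, binaryForm l ((-1 : ℂ) ^ l • A) w = binaryForm l A (spinorZ Real.pi w) :=
    fun w => by
      have := congrFun (hT.tensorForm_rotation Real.pi 0 0 r) w
      rw [funext fun i => eulerRot_pi_mulVec (h2 i), Function.comp_apply,
        spinorRot_zero_zero] at this
      refine Eq.trans ?_ this
      rw [hA, ← map_smul, tensorForm]
      refine congrArg (fun t => binaryForm l (complexComp l t) w) (funext fun μ => ?_)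
      rw [hT.inversion]
      push_cast
      rfl
  refine binaryForm_mem fun m hm => ?_
  have hm' := Finset.mem_Icc.1 m.2
  have h := coeff_eq_of_binaryForm_spinorZ hinv m
  rw [show Complex.I * (m : ℤ) * Real.pi = (m : ℤ) * (Real.pi * Complex.I) by ring,
    Complex.exp_int_mul, Complex.exp_pi_mul_I, Pi.smul_apply, smul_eq_mul] at h
  have h' : (-1 : ℂ) ^ ((l : ℤ) + m) = 1 := by
    rw [zpow_add₀ (by norm_num), ← mul_right_cancel₀ hm h, zpow_natCast, ← mul_pow]
    norm_num
  have heven : Even ((l : ℤ) + m) := by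
    by_contra hodd
    rw [Int.not_even_iff_odd] at hodd
    rw [hodd.neg_one_zpow] at h'
    norm_num at h'
  obtain ⟨a, ha⟩ := heven
  -- With `l + m = 2 a`, the monomial is `(u²)^a (v²)^(l - a)`.
  convert pow_mul_pow_mem_vecFormSpan_pow (fst_sq_mem hx hy) (snd_sq_mem hx hy)
    (show a.toNat + (l - a.toNat) = l by omega) using 1
  ext w
  rw [show ((l : ℤ) + m).toNat = 2 * a.toNat by omega,
    show ((l : ℤ) - m).toNat = 2 * (l - a.toNat) by omega, pow_mul, pow_mul]
  rfl

theorem IsProperHarmonicTensor.tensorForm_mem_of_coplanar (hT : IsProperHarmonicTensor n l T)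
    {r : Fin n → Fin 3 → ℝ} {w : Fin 3 → ℝ} (hw : w ≠ 0) (h : ∀ i, w ⬝ᵥ r i = 0) :
    tensorForm T r ∈ vecFormSpan r ^ l := by
  obtain ⟨α, β, c, rfl⟩ := exists_eulerRot_mulVec w
  have hc : c ≠ 0 := by
    rintro rfl
    refine hw ?_
    rw [show (![0, 0, 0] : Fin 3 → ℝ) = 0 by ext i; fin_cases i <;> rfl, Matrix.mulVec_zero]
  -- Undoing the rotation that takes the `z` axis to the normal `w` moves all vectors into the `xy`
  -- plane.
  have hr : r = fun i => eulerRot α β 0 *ᵥ (eulerRot (-0) (-β) (-α) *ᵥ r i) :=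
    funext fun i => (eulerRot_mulVec_neg_mulVec α β 0 (r i)).symm
  rw [hr]
  refine hT.tensorForm_mem_rotation α β 0 (hT.tensorForm_mem_of_xyPlane fun i => ?_)
  have := h i
  rw [← Matrix.vecMul_transpose, ← Matrix.dotProduct_mulVec, eulerRot_transpose] at this
  simpa [dotProduct, Fin.sum_univ_three, hc] using this

theorem IsProperHarmonicTensor.tensorForm_mem (hT : IsProperHarmonicTensor n l T)
    (r : Fin n → Fin 3 → ℝ) : tensorForm T r ∈ vecFormSpan r ^ l := by
  by_cases h : Submodule.span ℝ (Set.range r) = ⊤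
  · exact binaryForm_mem_of_span_eq_top h _
  -- A proper subspace is killed by a nonzero functional, whose coordinates give a normal vector.
  · obtain ⟨f, hf, hle⟩ := Submodule.exists_le_ker_of_lt_top _ (lt_top_iff_ne_top.2 h)
    have hfv : ∀ v, (fun i => f (Pi.single i 1)) ⬝ᵥ v = f v := fun v => by
      conv_rhs => rw [← LinearMap.sum_single_apply (fun _ => ℝ) v, map_sum]
      refine Finset.sum_congr rfl fun i _ => ?_
      rw [mul_comm, ← smul_eq_mul, ← map_smul]
      congr 1
      ext j
      by_cases hj : j = i
      · subst hj; simp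
      · simp [hj]
    refine hT.tensorForm_mem_of_coplanar (w := fun i => f (Pi.single i 1)) (fun hw => hf ?_)
      fun i => ?_
    · ext v
      simpa using congrFun hw v
    · rw [hfv]
      exact hle (Submodule.subset_span ⟨i, rfl⟩)

/-! ### From forms back to tensors, and descent to real coefficients -/

theorem vecFormSpan_pow_eq_span (r : Fin n → Fin 3 → ℝ) (l : ℕ) :
    vecFormSpan r ^ l = Submodule.span ℂ
      (Set.range fun i : Fin l → Fin n => fun w => ∏ j, vecForm (r (i j)) w) := by
  rw [vecFormSpan, Submodule.span_pow]
  congr 1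
  ext f
  rw [Set.mem_pow]
  simp only [List.prod_ofFn, Set.mem_range]
  constructor
  · rintro ⟨g, rfl⟩
    choose i hi using fun j => (g j).2
    refine ⟨i, funext fun w => ?_⟩
    simp only [← hi, Finset.prod_apply]
  · rintro ⟨i, rfl⟩
    refine ⟨fun j => ⟨_, i j, rfl⟩, ?_⟩
    ext w
    simp only [Finset.prod_apply]

/-- The encoding as forms is linear and injective, and it sends couplings to products up to the
nonzero constant `K`, so membership pulls back. -/
theorem IsProperHarmonicTensor.mem_complex_span (hT : IsProperHarmonicTensor n l T)
    (r : Fin n → Fin 3 → ℝ) :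
    (fun μ : MIdx l => (T r μ : ℂ)) ∈ Submodule.span ℂ (Set.range fun i : Fin l → Fin n =>
        maximalCoupling l (fun j => r (i j))) := by
  obtain ⟨K, hK, h⟩ := exists_binaryForm_maximalCoupling l
  set Φ := binaryForm l ∘ₗ complexComp l with hΦ
  have hinj : Function.Injective Φ := (binaryForm_injective l).comp (complexComp_injective l)
  have hmem : Φ (fun μ => (T r μ : ℂ)) ∈ Submodule.map Φ (Submodule.span ℂ
      (Set.range fun i : Fin l → Fin n => maximalCoupling l (fun j => r (i j)))) := by
    have hle : vecFormSpan r ^ l ≤ Submodule.map Φ (Submodule.span ℂ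
      (Set.range fun i : Fin l → Fin n => maximalCoupling l (fun j => r (i j)))) := by
      rw [vecFormSpan_pow_eq_span, Submodule.span_le]
      rintro _ ⟨i, rfl⟩
      refine ⟨K⁻¹ • maximalCoupling l (fun j => r (i j)),
        Submodule.smul_mem _ _ (Submodule.subset_span ⟨i, rfl⟩), ?_⟩
      ext w
      rw [map_smul, Pi.smul_apply, hΦ, LinearMap.comp_apply, h, smul_eq_mul,
        inv_mul_cancel_left₀ hK]
    exact hle (hT.tensorForm_mem r)
  obtain ⟨t, ht, hte⟩ := hmem
  rwa [← hinj hte]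

/-- A real vector in the complex span of real vectors lies in their real span. -/
theorem mem_real_span_of_mem_complex_span {ι κ : Type*} [Fintype ι] {v : ι → κ → ℂ} {t : κ → ℂ}
    (hv : ∀ i k, starRingEnd ℂ (v i k) = v i k) (ht : ∀ k, starRingEnd ℂ (t k) = t k)
    (h : t ∈ Submodule.span ℂ (Set.range v)) : t ∈ Submodule.span ℝ (Set.range v) := by
  obtain ⟨c, rfl⟩ := (Submodule.mem_span_range_iff_exists_fun ℂ).1 h
  -- Since the `v i` and the target are real, taking real parts of the coefficients preserves the
  -- relation.
  refine (Submodule.mem_span_range_iff_exists_fun ℝ).2 ⟨fun i => (c i).re, ?_⟩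
  ext k
  rw [← Complex.conj_eq_iff_re.1 (ht k)]
  simp only [Finset.sum_apply, Pi.smul_apply, smul_eq_mul, Complex.re_sum, Complex.ofReal_sum,
    Complex.real_smul]
  refine Finset.sum_congr rfl fun i _ => ?_
  rw [Complex.mul_re, Complex.conj_eq_iff_im.1 (hv i k), mul_zero, sub_zero, Complex.ofReal_mul,
    Complex.conj_eq_iff_re.1 (hv i k)]

theorem proposition1 (n l : ℕ) (T : (Fin n → Fin 3 → ℝ) → MIdx l → ℝ)
    (hT : IsProperHarmonicTensor n l T) (r : Fin n → Fin 3 → ℝ) :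
    (fun μ : MIdx l => (T r μ : ℂ)) ∈
      Submodule.span ℝ (Set.range fun i : Fin l → Fin n =>
        maximalCoupling l (fun j => r (i j))) :=
  mem_real_span_of_mem_complex_span (fun _ _ => conj_maximalCoupling l _ _)
    (fun _ => Complex.conj_ofReal _) (hT.mem_complex_span r)
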